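/- Let $p\ge 1$ and $n>p+1$ be integers, let $\Sigma$ be a real symmetric positive definite $p\times p$ matrix, and let $h=h_{np}:[0,\infty)\to[0,\infty)$ be a (Borel) density generator in dimension $np$, i.e. $\frac{\pi^{np/2}}{\Gamma(np/2)}\int_0^\infty h(t)\,t^{np/2-1}\,dt=1$. A random matrix $X\in\mathbb R^{p\times n}$ has the elliptical distribution $\mathcal E_{p,n}(0,\Sigma,I_n,h)$ if its column-wise vectorization $x=\mathrm{vec}(X)\in\mathbb R^{np}$ has the density $x\mapsto|I_n\otimes\Sigma|^{-1/2}\,h\big(x^\top(I_n\otimes\Sigma)^{-1}x\big)$ with respect to Lebesgue measure; the Elliptical Wishart distribution $\mathcal{EW}(n,\Sigma,h)$ is then the law of $XX^\top$. A random $p\times p$ matrix $S$ has the Inverse Elliptical Wishart distribution $\mathcal{EW}^{-1}(n,\Sigma,h)$ if $S^{-1}\sim\mathcal{EW}(n,\Sigma^{-1},h)$. Put $$m_{-1}=\frac{\pi^{np/2}}{\Gamma(np/2)}\int_0^\infty h(t)\,t^{np/2-2}\,dt .$$ **Proposition (Expectation).** If $m_{-1}$ is finite and $S\sim\mathcal{EW}^{-1}(n,\Sigma,h)$,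 then every entry of $S$ is integrable and $$E[S]=\frac{np-2}{n-p-1}\,m_{-1}\,\Sigma .$$ -/

import Mathlib

open MeasureTheory ProbabilityTheory
open scoped Kronecker

noncomputable section

namespace EllipticalWishart

/-- The real function `h`, of which only the values on `[0, ∞)` matter, is a density generator in
dimension `d`: on `[0, ∞)` it is Borel measurable and nonnegative, and
`π ^ (d/2) / Γ(d/2) * ∫₀^∞ h(t) t ^ (d/2 - 1) dt = 1`, the integral being convergent. -/
structure IsDensityGenerator (d : ℕ) (h : ℝ → ℝ) : Prop where
  measurable : Measurable fun t : Set.Ici (0 : ℝ) => h t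
  nonneg : ∀ t, 0 ≤ t → 0 ≤ h t
  integrable : IntegrableOn (fun t : ℝ => h t * t ^ ((d : ℝ) / 2 - 1)) (Set.Ioi 0)
  normalized : Real.pi ^ ((d : ℝ) / 2) / Real.Gamma ((d : ℝ) / 2) *
    ∫ t in Set.Ioi (0 : ℝ), h t * t ^ ((d : ℝ) / 2 - 1) = 1

/-- The modular moment `m_k` of a density generator `h` in dimension `d`, for `k : ℤ`:
`π ^ (d/2) / Γ(d/2) * ∫₀^∞ h(t) t ^ (d/2 + k - 1) dt`. -/
def modularMoment (d : ℕ) (h : ℝ → ℝ) (k : ℤ) : ℝ :=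
  Real.pi ^ ((d : ℝ) / 2) / Real.Gamma ((d : ℝ) / 2) *
    ∫ t in Set.Ioi (0 : ℝ), h t * t ^ ((d : ℝ) / 2 + (k : ℝ) - 1)

/-- The moment `m_k` is finite: the integral that defines it converges. -/
def FiniteModularMoment (d : ℕ) (h : ℝ → ℝ) (k : ℤ) : Prop :=
  IntegrableOn (fun t : ℝ => h t * t ^ ((d : ℝ) / 2 + (k : ℝ) - 1)) (Set.Ioi 0)

/-- The centered multivariate elliptical distribution on `ℝ^ι`: the measure with density
`x ↦ |Σ| ^ (-1/2) h(xᵀ Σ⁻¹ x)` with respect to Lebesgue measure. -/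
def ellipticalVector {ι : Type*} [Fintype ι] [DecidableEq ι]
    (Sig : Matrix ι ι ℝ) (h : ℝ → ℝ) : Measure (ι → ℝ) :=
  volume.withDensity fun x =>
    ENNReal.ofReal (Sig.det ^ (-(1 / 2) : ℝ) * h (x ⬝ᵥ (Sig⁻¹).mulVec x))

/-- Real matrices carry the product sigma-algebra of their entries. -/
instance matrixMeasurableSpace {p n : ℕ} : MeasurableSpace (Matrix (Fin p) (Fin n) ℝ) :=
  inferInstanceAs (MeasurableSpace (Fin p → Fin n → ℝ))

/-- The `p × n` matrix whose column-wise vectorization `Matrix.vec` is `x`. -/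
def unvec {p n : ℕ} (x : Fin n × Fin p → ℝ) : Matrix (Fin p) (Fin n) ℝ :=
  Matrix.of fun i j => x (j, i)

theorem vec_unvec {p n : ℕ} (x : Fin n × Fin p → ℝ) : (unvec x).vec = x := rfl

theorem unvec_vec {p n : ℕ} (X : Matrix (Fin p) (Fin n) ℝ) : unvec X.vec = X := rfl

theorem measurable_unvec {p n : ℕ} :
    Measurable (unvec : (Fin n × Fin p → ℝ) → Matrix (Fin p) (Fin n) ℝ) :=
  measurable_pi_lambda _ fun i => measurable_pi_lambda _ fun j => measurable_pi_apply (j, i)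

theorem measurable_entry {p n : ℕ} (i : Fin p) (j : Fin n) :
    Measurable fun X : Matrix (Fin p) (Fin n) ℝ => X i j :=
  (measurable_pi_apply j).comp (measurable_pi_apply (X := fun _ : Fin p => Fin n → ℝ) i)

theorem measurable_mul_transpose {p n : ℕ} :
    Measurable fun X : Matrix (Fin p) (Fin n) ℝ => X * X.transpose := by
  refine measurable_pi_lambda _ fun i => measurable_pi_lambda _ fun j => ?_
  have key : Measurable fun X : Matrix (Fin p) (Fin n) ℝ => ∑ k, X i k * X j k :=
    Finset.measurable_sum _ fun k _ => (measurable_entry i k).mul (measurable_entry j k)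
  exact key

/-- The centered matrix-variate elliptical distribution on `p × n` matrices: the law of the
matrix `X` for which `vec X` is elliptical with covariance matrix `Ψ ⊗ Σ`. -/
def ellipticalMatrix {p n : ℕ} (Sig : Matrix (Fin p) (Fin p) ℝ) (Psi : Matrix (Fin n) (Fin n) ℝ)
    (h : ℝ → ℝ) : Measure (Matrix (Fin p) (Fin n) ℝ) :=
  (ellipticalVector (Psi ⊗ₖ Sig) h).map unvec

/-- The Elliptical Wishart distribution: the law of `X Xᵀ` where the `p × n` matrix `X` is
elliptical with parameters `Σ`, `I_n` and `h`. -/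
def ellipticalWishart {p : ℕ} (n : ℕ) (Sig : Matrix (Fin p) (Fin p) ℝ) (h : ℝ → ℝ) :
    Measure (Matrix (Fin p) (Fin p) ℝ) :=
  (ellipticalMatrix Sig (1 : Matrix (Fin n) (Fin n) ℝ) h).map fun X => X * X.transpose

/-- The random matrix `S` has the Inverse Elliptical Wishart distribution: `S⁻¹` has the Elliptical
Wishart distribution with center `Σ⁻¹`. -/
def IsInverseEllipticalWishart {Ω : Type*} [MeasurableSpace Ω] {p : ℕ} (n : ℕ)
    (Sig : Matrix (Fin p) (Fin p) ℝ) (h : ℝ → ℝ)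
    (S : Ω → Matrix (Fin p) (Fin p) ℝ) (P : Measure Ω) : Prop :=
  AEMeasurable S P ∧ HasLaw (fun ω => (S ω)⁻¹) (ellipticalWishart n Sig⁻¹ h) P

/-- The entrywise expectation of a random matrix. -/
def matrixExpectation {Ω : Type*} [MeasurableSpace Ω] {p : ℕ}
    (S : Ω → Matrix (Fin p) (Fin p) ℝ) (P : Measure Ω) : Matrix (Fin p) (Fin p) ℝ :=
  Matrix.of fun i j => ∫ ω, S ω i j ∂P

end EllipticalWishart

end

/-! Factor `Sig = Bᵀ B`. The change of variables by `1 ⊗ B` turns the elliptical density into the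
spherical one `h (x ⬝ᵥ x)`, so that `S` has the law of `Bᵀ (scatter x)⁻¹ B`
(`ellipticalWishart_inv_eq_map`). It remains to show that `(scatter x)⁻¹` has spherical mean `c •
1`.

Off the diagonal, changing the sign of one row of `X` preserves the spherical measure and negates
the entry (`integral_inv_scatter_of_ne`).

On the diagonal, the entry is homogeneous of degree `-2` in `x`. In polar coordinates its integral
against any radial profile `g` is therefore `C * ∫ t ^ (d/2 - 2) g t`, with `d = n * p` and `C`
independent of `g` (`exists_lintegral_homogeneous_mul_radial`). The profile `exp (-t)` determines
`C`: the entry is the inverse squared distance from one row to the span of the others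
(`inv_gram_apply_self`), and for Gaussian rows this is the inverse squared norm of a Gaussian vector
in dimension `k = n - p + 1`, of mean `2 / (k - 2) = 2 / (n - p - 1)`. Division by `Γ(d/2 - 1) =
Γ(d/2) / (d/2 - 1)` produces the factor `d - 2`.

The diagonal computations use `ENNReal`-valued integrals, so finiteness is a result of them;
positive semidefiniteness then controls the other entries. -/

namespace EllipticalWishart

/-! ### Polar coordinates for homogeneous functions -/

section Polar

variable {E : Type*} [NormedAddCommGroup E] [NormedSpace ℝ E] [MeasurableSpace E] [BorelSpace E]
  [FiniteDimensional ℝ E] [Nontrivial E]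

/-- Substitution of the square root in an integral over the positive half-line. -/
theorem lintegral_Ioi_comp_sq (f : ℝ → ENNReal) :
    ∫⁻ r in Set.Ioi (0 : ℝ), ENNReal.ofReal (2 * r) * f (r ^ 2) =
      ∫⁻ t in Set.Ioi (0 : ℝ), f t := by
  have himage : (fun r : ℝ => r ^ 2) '' Set.Ioi 0 = Set.Ioi 0 := by
    ext t
    constructor
    · rintro ⟨r, hr, rfl⟩
      exact pow_pos (Set.mem_Ioi.1 hr) 2
    · intro ht
      exact ⟨√t, Real.sqrt_pos.2 ht, Real.sq_sqrt (le_of_lt ht)⟩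
  have hinj : Set.InjOn (fun r : ℝ => r ^ 2) (Set.Ioi 0) := fun a ha b hb hab =>
    (pow_left_inj₀ (le_of_lt ha) (le_of_lt hb) two_ne_zero).1 hab
  have := lintegral_image_eq_lintegral_abs_deriv_mul (f' := fun r : ℝ => 2 * r) measurableSet_Ioi
    (fun r _ => by simpa using (hasDerivAt_pow 2 r).hasDerivWithinAt) hinj f
  rw [← himage, this, himage]
  refine setLIntegral_congr_fun measurableSet_Ioi fun r hr => ?_
  rw [abs_of_pos (by simpa using hr)]

/-- Polar integration of a function that is homogeneous of degree `-2` against a radial one. -/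
theorem exists_lintegral_homogeneous_mul_radial (μ : Measure E) [μ.IsAddHaarMeasure]
    {F : E → ENNReal} (hF : Measurable F)
    (hhom : ∀ r : ℝ, 0 < r → ∀ x, F (r • x) = (ENNReal.ofReal (r ^ 2))⁻¹ * F x) :
    ∃ C : ENNReal, ∀ g : ℝ → ENNReal, Measurable g →
      ∫⁻ x, F x * g (‖x‖ ^ 2) ∂μ =
        C * ∫⁻ t in Set.Ioi (0 : ℝ),
          ENNReal.ofReal (t ^ ((Module.finrank ℝ E : ℝ) / 2 - 2)) * g t := by
  have hd : 0 < Module.finrank ℝ E := Module.finrank_pos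
  -- The spherical integral of `F`, times the `1 / 2` from `dt = 2 r dr` with `t = r ^ 2`.
  refine ⟨(∫⁻ u, F (u : E) ∂μ.toSphere) * ENNReal.ofReal (1 / 2), fun g hg => ?_⟩
  have h1 : ∫⁻ x, F x * g (‖x‖ ^ 2) ∂μ =
      ∫⁻ z : Metric.sphere (0 : E) 1 × Set.Ioi (0 : ℝ),
        F (z.1 : E) * ((ENNReal.ofReal ((z.2 : ℝ) ^ 2))⁻¹ * g ((z.2 : ℝ) ^ 2))
        ∂(μ.toSphere.prod (Measure.volumeIoiPow (Module.finrank ℝ E - 1))) := by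
    rw [← (μ.measurePreserving_homeomorphUnitSphereProd).lintegral_comp_emb
      (Homeomorph.measurableEmbedding _)]
    have : ∀ x : ({(0 : E)}ᶜ : Set E),
        F ((homeomorphUnitSphereProd E x).1 : E) *
          ((ENNReal.ofReal (((homeomorphUnitSphereProd E x).2 : ℝ) ^ 2))⁻¹ *
            g (((homeomorphUnitSphereProd E x).2 : ℝ) ^ 2)) = F x * g (‖(x : E)‖ ^ 2) := by
      intro x
      have hx : 0 < ‖(x : E)‖ := norm_pos_iff.2 x.2
      have h2 := hhom _ hx ((homeomorphUnitSphereProd E x).1 : E)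
      simp only [homeomorphUnitSphereProd_apply_fst_coe,
        homeomorphUnitSphereProd_apply_snd_coe] at h2 ⊢
      rw [smul_inv_smul₀ hx.ne'] at h2
      rw [h2]
      ring
    simp_rw [this]
    rw [lintegral_subtype_comap (measurableSet_singleton _).compl
      (fun x => F x * g (‖x‖ ^ 2)), restrict_compl_singleton]
  have hFm : Measurable fun u : Metric.sphere (0 : E) 1 => F (u : E) :=
    hF.comp measurable_subtype_coe
  have hgm : Measurable fun r : Set.Ioi (0 : ℝ) =>
      (ENNReal.ofReal ((r : ℝ) ^ 2))⁻¹ * g ((r : ℝ) ^ 2) := by fun_prop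
  rw [h1, lintegral_prod_mul hFm.aemeasurable hgm.aemeasurable, mul_assoc]
  congr 1
  rw [Measure.volumeIoiPow, lintegral_withDensity_eq_lintegral_mul _ (by fun_prop) hgm]
  simp only [Pi.mul_apply]
  rw [lintegral_subtype_comap measurableSet_Ioi (fun r : ℝ =>
      ENNReal.ofReal (r ^ (Module.finrank ℝ E - 1)) *
        ((ENNReal.ofReal (r ^ 2))⁻¹ * g (r ^ 2))),
    ← lintegral_Ioi_comp_sq (fun t =>
      ENNReal.ofReal (t ^ ((Module.finrank ℝ E : ℝ) / 2 - 2)) * g t),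
    ← lintegral_const_mul _ (by fun_prop)]
  refine setLIntegral_congr_fun measurableSet_Ioi fun r hr => ?_
  have hr : 0 < r := hr
  rw [← mul_assoc, ← mul_assoc, ← mul_assoc, ← ENNReal.ofReal_inv_of_pos (by positivity),
    ← ENNReal.ofReal_mul (by positivity), ← ENNReal.ofReal_mul (by positivity),
    ← ENNReal.ofReal_mul (by positivity)]
  congr 2
  rw [← Real.rpow_natCast r 2, ← Real.rpow_mul hr.le, ← Real.rpow_neg hr.le,
    ← Real.rpow_natCast, ← Real.rpow_add hr,
    show 1 / 2 * (2 * r) = r ^ (1 : ℝ) by rw [Real.rpow_one]; ring, ← Real.rpow_add hr]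
  congr 1
  push_cast [Nat.cast_sub (show 1 ≤ Module.finrank ℝ E from hd)]
  ring

end Polar

/-! ### Gaussian integrals and the inverse second moment -/

section Gaussian

variable {V : Type*} [NormedAddCommGroup V] [InnerProductSpace ℝ V] [MeasurableSpace V]
  [BorelSpace V] [FiniteDimensional ℝ V]

theorem lintegral_exp_neg_norm_sq :
    ∫⁻ v : V, ENNReal.ofReal (Real.exp (-‖v‖ ^ 2)) =
      ENNReal.ofReal (Real.pi ^ ((Module.finrank ℝ V : ℝ) / 2)) := by
  have h := GaussianFourier.integral_rexp_neg_mul_sq_norm (V := V) one_pos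
  simp only [neg_mul, one_mul, div_one] at h
  rw [← h, ofReal_integral_eq_lintegral_ofReal]
  -- A non-integrable function would have integral `0`, but the known value is positive.
  · by_contra hc
    rw [integral_undef hc] at h
    have : 0 < Real.pi ^ ((Module.finrank ℝ V : ℝ) / 2) := by positivity
    exact this.ne h
  · exact Filter.Eventually.of_forall fun v => (Real.exp_pos _).le

theorem lintegral_rpow_mul_exp_neg {a : ℝ} (ha : 0 < a) :
    ∫⁻ t in Set.Ioi (0 : ℝ), ENNReal.ofReal (t ^ (a - 1)) * ENNReal.ofReal (Real.exp (-t)) =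
      ENNReal.ofReal (Real.Gamma a) := by
  rw [Real.Gamma_eq_integral ha, ofReal_integral_eq_lintegral_ofReal
    (Real.GammaIntegral_convergent ha)]
  · refine setLIntegral_congr_fun measurableSet_Ioi fun t ht => ?_
    have ht : 0 < t := ht
    rw [← ENNReal.ofReal_mul (by positivity), mul_comm]
  · filter_upwards [ae_restrict_mem measurableSet_Ioi] with t ht
    have ht : 0 < t := ht
    simp only [Pi.zero_apply]
    positivity

theorem inv_norm_sq_homogeneous {W : Type*} [NormedAddCommGroup W] [NormedSpace ℝ W]
    (r : ℝ) (hr : 0 < r) (x : W) :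
    (ENNReal.ofReal (‖r • x‖ ^ 2))⁻¹ =
      (ENNReal.ofReal (r ^ 2))⁻¹ * (ENNReal.ofReal (‖x‖ ^ 2))⁻¹ := by
  rw [norm_smul, mul_pow, Real.norm_of_nonneg hr.le, ENNReal.ofReal_mul (by positivity),
    ENNReal.mul_inv (Or.inl (by simpa using hr.ne')) (Or.inl ENNReal.ofReal_ne_top)]

/-- The inverse moment of order two of a Gaussian vector. -/
theorem lintegral_inv_norm_sq_mul_exp (hV : 2 < Module.finrank ℝ V) :
    ∫⁻ v : V, (ENNReal.ofReal (‖v‖ ^ 2))⁻¹ * ENNReal.ofReal (Real.exp (-‖v‖ ^ 2)) =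
      ENNReal.ofReal (2 / ((Module.finrank ℝ V : ℝ) - 2)) *
        ENNReal.ofReal (Real.pi ^ ((Module.finrank ℝ V : ℝ) / 2)) := by
  have : Nontrivial V := Module.nontrivial_of_finrank_pos (R := ℝ) (by omega)
  set k : ℝ := (Module.finrank ℝ V : ℝ) with hk
  have hk2 : 2 < k := by rw [hk]; exact_mod_cast hV
  obtain ⟨C, hC⟩ := exists_lintegral_homogeneous_mul_radial (volume : Measure V)
    (F := fun v => (ENNReal.ofReal (‖v‖ ^ 2))⁻¹) (by fun_prop) inv_norm_sq_homogeneous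
  -- Two profiles share the unknown `C`: `exp (-t)` gives the desired moment, while `t * exp (-t)`
  -- cancels the singularity and gives the plain Gaussian mass. Their ratio is `Γ(k/2 - 1) / Γ(k/2)
  -- = 2 / (k - 2)`.
  have h1 := hC (fun t => ENNReal.ofReal (Real.exp (-t))) (by fun_prop)
  have h2 := hC (fun t => ENNReal.ofReal t * ENNReal.ofReal (Real.exp (-t))) (by fun_prop)
  rw [← hk, show k / 2 - 2 = (k / 2 - 1) - 1 by ring,
    lintegral_rpow_mul_exp_neg (by linarith)] at h1
  have h3 : ∫⁻ v : V, (ENNReal.ofReal (‖v‖ ^ 2))⁻¹ *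
      (ENNReal.ofReal (‖v‖ ^ 2) * ENNReal.ofReal (Real.exp (-‖v‖ ^ 2))) =
      ENNReal.ofReal (Real.pi ^ (k / 2)) := by
    rw [hk, ← lintegral_exp_neg_norm_sq (V := V)]
    have h0 : ∀ᵐ v : V, v ≠ 0 := by
      simp [ae_iff]
    refine lintegral_congr_ae ?_
    filter_upwards [h0] with v hv
    have : 0 < ‖v‖ := norm_pos_iff.2 hv
    rw [← mul_assoc, ENNReal.inv_mul_cancel, one_mul]
    · simpa using hv
    · exact ENNReal.ofReal_ne_top
  have h4 : ∫⁻ t in Set.Ioi (0 : ℝ), ENNReal.ofReal (t ^ (k / 2 - 2)) *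
      (ENNReal.ofReal t * ENNReal.ofReal (Real.exp (-t))) =
      ENNReal.ofReal (Real.Gamma (k / 2)) := by
    rw [← lintegral_rpow_mul_exp_neg (by linarith)]
    refine setLIntegral_congr_fun measurableSet_Ioi fun t ht => ?_
    have ht : 0 < t := ht
    rw [← mul_assoc, ← ENNReal.ofReal_mul (by positivity)]
    congr 2
    nth_rewrite 2 [← Real.rpow_one t]
    rw [← Real.rpow_add ht]
    ring_nf
  rw [← hk, h3, h4] at h2
  have hG : Real.Gamma (k / 2) = (k / 2 - 1) * Real.Gamma (k / 2 - 1) := by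
    have := Real.Gamma_add_one (s := k / 2 - 1) (by linarith)
    rwa [sub_add_cancel] at this
  have hGpos : 0 < Real.Gamma (k / 2 - 1) := Real.Gamma_pos_of_pos (by linarith)
  rw [h1, h2, mul_left_comm, ← ENNReal.ofReal_mul (by positivity), hG]
  congr 2
  field_simp [show k - 2 ≠ 0 by linarith]

end Gaussian

/-! ### Inverse Gram matrices of Gaussian families -/

section Gram

variable {E : Type*} [NormedAddCommGroup E] [InnerProductSpace ℝ E]

section Algebra

variable [FiniteDimensional ℝ E]

/-- A diagonal entry of the inverse of a Gram matrix is the inverse squared distance of the vector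
to the span of the other ones. -/
theorem inv_gram_apply_self {m : ℕ} (v : Fin (m + 1) → E) (i : Fin (m + 1))
    (hv : (Matrix.gram ℝ v).det ≠ 0) :
    ENNReal.ofReal ((Matrix.gram ℝ v)⁻¹ i i) =
      (ENNReal.ofReal (‖(Submodule.span ℝ
        (Set.range fun j => v (i.succAbove j)))ᗮ.starProjection (v i)‖ ^ 2))⁻¹ := by
  set G := Matrix.gram ℝ v with hG
  set K := Submodule.span ℝ (Set.range fun j => v (i.succAbove j)) with hK
  -- The `i`-th vector of the dual basis: orthogonal to every other `v j`, with `⟪w, v i⟫ = 1` and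
  -- `‖w‖ ^ 2 = G⁻¹ i i`. Hence the component of `v i` in `Kᗮ` is `w / ‖w‖ ^ 2`.
  set w : E := ∑ j, G⁻¹ i j • v j with hw
  have hwv : ∀ k, inner ℝ w (v k) = (1 : Matrix _ _ ℝ) i k := fun k => by
    rw [← Matrix.nonsing_inv_mul G (isUnit_iff_ne_zero.2 hv), Matrix.mul_apply, hw, sum_inner]
    simp [inner_smul_left, hG, Matrix.gram_apply]
  have hww : inner ℝ w w = G⁻¹ i i := by
    conv_lhs => rw [hw, inner_sum]
    simp only [inner_smul_right, ← hw, hwv]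
    simp [Matrix.one_apply]
  have hwK : w ∈ Kᗮ := by
    rw [Submodule.mem_orthogonal', hK]
    intro u hu
    induction hu using Submodule.span_induction with
    | mem x hx =>
      obtain ⟨j, rfl⟩ := hx
      simp [hwv, (Fin.succAbove_ne i j).symm]
    | zero => simp
    | add x y _ _ hx hy => simp [inner_add_right, hx, hy]
    | smul a x _ hx => simp [inner_smul_right, hx]
  have hw0 : w ≠ 0 := by
    intro h0
    have := hwv i
    simp [h0] at this
  have hpos : 0 < G⁻¹ i i := by
    rw [← hww]
    exact real_inner_self_pos.2 hw0
  have hproj : Kᗮ.starProjection (v i) = (G⁻¹ i i)⁻¹ • w := by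
    refine Submodule.eq_starProjection_of_mem_orthogonal (Submodule.smul_mem _ _ hwK) ?_
    rw [Submodule.orthogonal_orthogonal]
    have : v i - (G⁻¹ i i)⁻¹ • w =
        -((G⁻¹ i i)⁻¹ • ∑ j, G⁻¹ i (i.succAbove j) • v (i.succAbove j)) := by
      rw [hw, Fin.sum_univ_succAbove _ i, smul_add, smul_smul, inv_mul_cancel₀ hpos.ne', one_smul]
      abel
    rw [this]
    exact K.neg_mem (K.smul_mem _ (K.sum_mem fun j _ =>
      K.smul_mem _ (Submodule.subset_span ⟨j, rfl⟩)))
  rw [hproj, norm_smul, mul_pow, ← real_inner_self_eq_norm_sq w, hww, Real.norm_of_nonneg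
    (by positivity), ← ENNReal.ofReal_inv_of_pos (by positivity)]
  congr 1
  field_simp

end Algebra

variable [MeasurableSpace E] [BorelSpace E] [FiniteDimensional ℝ E]

theorem measurable_gram_det {ι : Type*} [Fintype ι] [DecidableEq ι] :
    Measurable fun v : ι → E => (Matrix.gram ℝ v).det :=
  (show Continuous fun v : ι → E => (Matrix.gram ℝ v).det from
    Continuous.matrix_det (continuous_matrix fun i j =>
      show Continuous fun v : ι → E => inner ℝ (v i) (v j) by fun_prop)).measurable

theorem measurable_inv_gram {ι : Type*} [Fintype ι] [DecidableEq ι] (i j : ι) :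
    Measurable fun v : ι → E => (Matrix.gram ℝ v)⁻¹ i j := by
  have hadj : Measurable fun v : ι → E => (Matrix.gram ℝ v).adjugate i j :=
    (Continuous.matrix_elem (Continuous.matrix_adjugate (continuous_matrix fun i j =>
      show Continuous fun v : ι → E => inner ℝ (v i) (v j) by fun_prop)) i j).measurable
  simp only [Matrix.inv_def, Ring.inverse_eq_inv', Matrix.smul_apply, smul_eq_mul]
  exact measurable_gram_det.inv.mul hadj

/-- Degeneracy forces `x` into the span of `v`, a proper subspace by dimension and hence a null set.
-/
theorem ae_det_gram_insertNth_ne_zero {m : ℕ} (hm : m < Module.finrank ℝ E) {v : Fin m → E}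
    (hv : LinearIndependent ℝ v) (i : Fin (m + 1)) :
    ∀ᵐ x : E, (Matrix.gram ℝ (i.insertNth x v : Fin (m + 1) → E)).det ≠ 0 := by
  have hK : Submodule.span ℝ (Set.range v) ≠ ⊤ := by
    intro h
    have := finrank_span_eq_card hv
    rw [h, finrank_top, Fintype.card_fin] at this
    omega
  have := Measure.addHaar_submodule (volume : Measure E) _ hK
  filter_upwards [compl_mem_ae_iff.2 this] with x hx
  rw [Matrix.det_gram_ne_zero_iff_linearIndependent]
  have h := hv.finCons hx
  -- Inserting at `i` differs from inserting at the front by a cyclic permutation.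
  rwa [← linearIndependent_equiv (Fin.cycleRange i), Fin.cons_comp_cycleRange] at h

theorem lintegral_pi_succAbove {m : ℕ} (i : Fin (m + 1)) {f : (Fin (m + 1) → E) → ENNReal}
    (hf : Measurable f) :
    ∫⁻ v, f v = ∫⁻ v : Fin m → E, ∫⁻ x : E, f (i.insertNth x v) := by
  have hmp := (volume_preserving_piFinSuccAbove (fun _ : Fin (m + 1) => E) i).symm
  rw [← hmp.lintegral_comp hf, Measure.volume_eq_prod]
  exact lintegral_prod_symm _ (hf.comp hmp.measurable).aemeasurable

theorem ae_det_gram_ne_zero {m : ℕ} (hm : m ≤ Module.finrank ℝ E) :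
    ∀ᵐ v : Fin m → E, (Matrix.gram ℝ v).det ≠ 0 := by
  induction m with
  | zero => simp
  | succ m ih =>
    have hset : MeasurableSet {v : Fin (m + 1) → E | (Matrix.gram ℝ v).det ≠ 0} :=
      measurable_gram_det (measurableSet_singleton 0).compl
    have hind : Measurable ({v : Fin (m + 1) → E | (Matrix.gram ℝ v).det ≠ 0}ᶜ.indicator
        (1 : (Fin (m + 1) → E) → ENNReal)) := measurable_one.indicator hset.compl
    rw [ae_iff]
    change volume {v : Fin (m + 1) → E | (Matrix.gram ℝ v).det ≠ 0}ᶜ = 0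
    rw [← lintegral_indicator_one hset.compl, lintegral_pi_succAbove 0 hind]
    refine (lintegral_congr_ae (g := 0) ?_).trans (by simp)
    filter_upwards [ih (by omega)] with v hv
    refine (lintegral_congr_ae (g := 0) ?_).trans (by simp)
    filter_upwards [ae_det_gram_insertNth_ne_zero (by omega)
      ((Matrix.det_gram_ne_zero_iff_linearIndependent).1 hv) 0] with x hx
    simpa using hx

/-- Along `E = K ⊕ Kᗮ` the Gaussian weight factors: `K` contributes only its mass, and `Kᗮ` the
inverse second moment in its own dimension. -/
theorem lintegral_inv_norm_sq_starProjection_mul_exp (K : Submodule ℝ E)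
    (hK : 2 < Module.finrank ℝ Kᗮ) :
    ∫⁻ x : E, (ENNReal.ofReal (‖Kᗮ.starProjection x‖ ^ 2))⁻¹ *
        ENNReal.ofReal (Real.exp (-‖x‖ ^ 2)) =
      ENNReal.ofReal (2 / ((Module.finrank ℝ Kᗮ : ℝ) - 2)) *
        ENNReal.ofReal (Real.pi ^ ((Module.finrank ℝ E : ℝ) / 2)) := by
  have hmp := (WithLp.volume_preserving_ofLp K Kᗮ).comp K.orthogonalDecomposition.measurePreserving
  set f : K × Kᗮ → ENNReal := fun z => ENNReal.ofReal (Real.exp (-‖z.1‖ ^ 2)) *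
    ((ENNReal.ofReal (‖z.2‖ ^ 2))⁻¹ * ENNReal.ofReal (Real.exp (-‖z.2‖ ^ 2))) with hf
  have hfm : Measurable f := by fun_prop
  have h1 : ∀ x : E, (ENNReal.ofReal (‖Kᗮ.starProjection x‖ ^ 2))⁻¹ *
        ENNReal.ofReal (Real.exp (-‖x‖ ^ 2)) =
      f ((WithLp.ofLp ∘ K.orthogonalDecomposition) x) := by
    intro x
    rw [K.norm_sq_eq_add_norm_sq_projection x, neg_add, Real.exp_add,
      ENNReal.ofReal_mul (Real.exp_pos _).le]
    simp [hf]
    ring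
  refine (lintegral_congr h1).trans ((hmp.lintegral_comp hfm).trans ?_)
  have h2 := lintegral_prod_mul (μ := (volume : Measure K)) (ν := (volume : Measure Kᗮ))
    (f := fun u => ENNReal.ofReal (Real.exp (-‖u‖ ^ 2)))
    (g := fun u => (ENNReal.ofReal (‖u‖ ^ 2))⁻¹ * ENNReal.ofReal (Real.exp (-‖u‖ ^ 2)))
    (by fun_prop) (by fun_prop)
  refine h2.trans ?_
  rw [lintegral_exp_neg_norm_sq,
    lintegral_inv_norm_sq_mul_exp hK, mul_left_comm, ← ENNReal.ofReal_mul (by positivity),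
    ← Real.rpow_add Real.pi_pos, ← K.finrank_add_finrank_orthogonal]
  push_cast
  ring_nf

theorem lintegral_exp_neg_sum_norm_sq (m : ℕ) :
    ∫⁻ v : Fin m → E, ENNReal.ofReal (Real.exp (-∑ k, ‖v k‖ ^ 2)) =
      ENNReal.ofReal (Real.pi ^ ((Module.finrank ℝ E : ℝ) * m / 2)) := by
  induction m with
  | zero => simp [volume_pi]
  | succ m ih =>
    rw [lintegral_pi_succAbove 0 (by fun_prop)]
    simp only [Fin.sum_univ_succAbove _ (0 : Fin (m + 1)), Fin.insertNth_apply_same,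
      Fin.insertNth_apply_succAbove, neg_add, Real.exp_add,
      ENNReal.ofReal_mul (Real.exp_pos _).le]
    have h1 : ∀ v : Fin m → E, ∫⁻ x : E, ENNReal.ofReal (Real.exp (-‖x‖ ^ 2)) *
        ENNReal.ofReal (Real.exp (-∑ k, ‖v k‖ ^ 2)) =
        ENNReal.ofReal (Real.pi ^ ((Module.finrank ℝ E : ℝ) / 2)) *
          ENNReal.ofReal (Real.exp (-∑ k, ‖v k‖ ^ 2)) := fun v => by
      rw [lintegral_mul_const _ (by fun_prop), lintegral_exp_neg_norm_sq]
    rw [lintegral_congr h1, lintegral_const_mul _ (by fun_prop), ih,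
      ← ENNReal.ofReal_mul (by positivity), ← Real.rpow_add Real.pi_pos]
    push_cast
    ring_nf

/-- The diagonal of the inverse Gram matrix of a Gaussian family. -/
theorem lintegral_inv_gram_mul_exp {m : ℕ} (hm : m + 2 < Module.finrank ℝ E) (i : Fin (m + 1)) :
    ∫⁻ v : Fin (m + 1) → E, ENNReal.ofReal ((Matrix.gram ℝ v)⁻¹ i i) *
        ENNReal.ofReal (Real.exp (-∑ k, ‖v k‖ ^ 2)) =
      ENNReal.ofReal (2 / ((Module.finrank ℝ E : ℝ) - m - 2)) *
        ENNReal.ofReal (Real.pi ^ ((Module.finrank ℝ E : ℝ) * (m + 1 : ℕ) / 2)) := by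
  have hmeas : Measurable fun v : Fin (m + 1) → E => ENNReal.ofReal ((Matrix.gram ℝ v)⁻¹ i i) *
        ENNReal.ofReal (Real.exp (-∑ k, ‖v k‖ ^ 2)) :=
    (measurable_inv_gram i i).ennreal_ofReal.mul (by fun_prop)
  rw [lintegral_pi_succAbove i hmeas]
  have h1 : ∀ᵐ v : Fin m → E, ∫⁻ x : E,
      ENNReal.ofReal ((Matrix.gram ℝ (i.insertNth x v : Fin (m + 1) → E))⁻¹ i i) *
        ENNReal.ofReal (Real.exp (-∑ k, ‖(i.insertNth x v : Fin (m + 1) → E) k‖ ^ 2)) =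
      ENNReal.ofReal (2 / ((Module.finrank ℝ E : ℝ) - m - 2)) *
        ENNReal.ofReal (Real.pi ^ ((Module.finrank ℝ E : ℝ) / 2)) *
        ENNReal.ofReal (Real.exp (-∑ k, ‖v k‖ ^ 2)) := by
    filter_upwards [ae_det_gram_ne_zero (show m ≤ Module.finrank ℝ E by omega)] with v hv
    rw [Matrix.det_gram_ne_zero_iff_linearIndependent] at hv
    set K := Submodule.span ℝ (Set.range v) with hK
    -- Independence of `v` fixes the dimension of `Kᗮ`, almost surely the same for all `v`; `hm`
    -- makes it exceed `2`.
    have hrank : m + Module.finrank ℝ Kᗮ = Module.finrank ℝ E := by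
      rw [← K.finrank_add_finrank_orthogonal, hK, finrank_span_eq_card hv, Fintype.card_fin]
    have hrank' : (Module.finrank ℝ E : ℝ) - m - 2 = (Module.finrank ℝ Kᗮ : ℝ) - 2 := by
      rw [← hrank]
      push_cast
      ring
    rw [hrank', ← lintegral_inv_norm_sq_starProjection_mul_exp K (by omega),
      ← lintegral_mul_const _ (by fun_prop)]
    refine lintegral_congr_ae ?_
    filter_upwards [ae_det_gram_insertNth_ne_zero (by omega) hv i] with x hx
    rw [inv_gram_apply_self _ i hx, Fin.sum_univ_succAbove _ i, neg_add, Real.exp_add,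
      ENNReal.ofReal_mul (Real.exp_pos _).le]
    simp only [Fin.insertNth_apply_same, Fin.insertNth_apply_succAbove]
    rw [← mul_assoc]
  rw [lintegral_congr_ae h1, lintegral_const_mul _ (by fun_prop), lintegral_exp_neg_sum_norm_sq,
    mul_assoc, ← ENNReal.ofReal_mul (by positivity), ← Real.rpow_add Real.pi_pos]
  push_cast
  ring_nf

end Gram

/-! ### The scatter matrix in coordinates -/

variable {n p : ℕ}

/-- The matrix `X Xᵀ` as a function of `vec X`. -/
noncomputable def scatter (x : Fin n × Fin p → ℝ) : Matrix (Fin p) (Fin p) ℝ :=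
  unvec x * (unvec x).transpose

/-- The vectorization of the matrix with prescribed rows. -/
def vecOfRows (v : Fin p → EuclideanSpace ℝ (Fin n)) : Fin n × Fin p → ℝ :=
  fun k => v k.2 k.1

theorem scatter_apply (x : Fin n × Fin p → ℝ) (i j : Fin p) :
    scatter x i j = ∑ k, x (k, i) * x (k, j) := rfl

theorem measurable_vecOfRows :
    Measurable (vecOfRows : (Fin p → EuclideanSpace ℝ (Fin n)) → Fin n × Fin p → ℝ) :=
  measurable_pi_lambda _ fun k => show Measurable fun v : Fin p → EuclideanSpace ℝ (Fin n) =>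
    v k.2 k.1 by fun_prop

theorem scatter_vecOfRows (v : Fin p → EuclideanSpace ℝ (Fin n)) :
    scatter (vecOfRows v) = Matrix.gram ℝ v := by
  ext i j
  rw [scatter_apply, Matrix.gram_apply, PiLp.inner_apply]
  exact Finset.sum_congr rfl fun k _ => by simp [vecOfRows, mul_comm]

theorem vecOfRows_dotProduct_self (v : Fin p → EuclideanSpace ℝ (Fin n)) :
    vecOfRows v ⬝ᵥ vecOfRows v = ∑ k, ‖v k‖ ^ 2 := by
  simp_rw [EuclideanSpace.norm_sq_eq, dotProduct, Fintype.sum_prod_type, vecOfRows]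
  rw [Finset.sum_comm]
  simp [sq]

theorem measurePreserving_vecOfRows :
    MeasurePreserving (vecOfRows : (Fin p → EuclideanSpace ℝ (Fin n)) → Fin n × Fin p → ℝ) := by
  refine ⟨measurable_vecOfRows, (Measure.pi_eq fun s hs => ?_).symm⟩
  rw [Measure.map_apply measurable_vecOfRows (MeasurableSet.univ_pi hs)]
  have h1 : (vecOfRows : (Fin p → EuclideanSpace ℝ (Fin n)) → _) ⁻¹' Set.univ.pi s =
      Set.univ.pi fun i => WithLp.ofLp ⁻¹' Set.univ.pi fun j => s (j, i) := by
    ext v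
    simp only [Set.mem_preimage, Set.mem_univ_pi, Prod.forall]
    exact forall_comm
  rw [h1, volume_pi_pi, Fintype.prod_prod_type, Finset.prod_comm]
  refine Finset.prod_congr rfl fun i _ => ?_
  rw [(PiLp.volume_preserving_ofLp (Fin n)).measure_preimage
    (MeasurableSet.univ_pi fun j => hs (j, i)).nullMeasurableSet, volume_pi_pi]

theorem continuous_scatter :
    Continuous (scatter : (Fin n × Fin p → ℝ) → Matrix (Fin p) (Fin p) ℝ) :=
  continuous_matrix fun i j => by
    simp only [scatter_apply]
    fun_prop

theorem measurable_scatter :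
    Measurable (scatter : (Fin n × Fin p → ℝ) → Matrix (Fin p) (Fin p) ℝ) :=
  measurable_mul_transpose.comp measurable_unvec

theorem measurable_det : Measurable fun A : Matrix (Fin p) (Fin p) ℝ => A.det := by
  simp only [Matrix.det_apply]
  exact Finset.measurable_sum _ fun σ _ =>
    (Finset.measurable_prod _ fun i _ => measurable_entry _ _).const_smul _

theorem measurable_inv_entry (i j : Fin p) :
    Measurable fun A : Matrix (Fin p) (Fin p) ℝ => A⁻¹ i j := by
  have hadj : Measurable fun A : Matrix (Fin p) (Fin p) ℝ => A.adjugate i j := by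
    simp only [Matrix.adjugate_apply]
    refine measurable_det.comp (measurable_pi_lambda _ fun k => measurable_pi_lambda _ fun l => ?_)
    by_cases hk : k = j
    · subst hk
      simp
    · simpa [Matrix.updateRow_ne hk] using measurable_entry k l
  simp only [Matrix.inv_def, Ring.inverse_eq_inv', Matrix.smul_apply, smul_eq_mul]
  exact measurable_det.inv.mul hadj

theorem ae_det_scatter_ne_zero (hpn : p ≤ n) :
    ∀ᵐ x : Fin n × Fin p → ℝ, (scatter x).det ≠ 0 := by
  have hset : MeasurableSet {x : Fin n × Fin p → ℝ | (scatter x).det ≠ 0} :=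
    (measurable_det.comp measurable_scatter) (measurableSet_singleton 0).compl
  rw [← measurePreserving_vecOfRows.map_eq, ae_map_iff measurable_vecOfRows.aemeasurable hset]
  simp only [scatter_vecOfRows]
  exact ae_det_gram_ne_zero (by simpa using hpn)

theorem scatter_smul (r : ℝ) (x : Fin n × Fin p → ℝ) :
    scatter (r • x) = r ^ 2 • scatter x := by
  ext i j
  simp only [scatter_apply, Matrix.smul_apply, Pi.smul_apply, smul_eq_mul, Finset.mul_sum]
  exact Finset.sum_congr rfl fun k _ => by ring

/-- For singular `A` both sides are the default value `0`, so homogeneity needs no exceptional set.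
-/
theorem inv_smul_of_ne_zero {ι : Type*} [Fintype ι] [DecidableEq ι] {r : ℝ} (hr : r ≠ 0)
    (A : Matrix ι ι ℝ) : (r • A)⁻¹ = r⁻¹ • A⁻¹ := by
  by_cases hA : IsUnit A.det
  · exact Matrix.inv_smul' A (Units.mk0 r hr) hA
  · rw [Matrix.nonsing_inv_apply_not_isUnit _ hA, smul_zero, Matrix.nonsing_inv_apply_not_isUnit]
    rw [Matrix.det_smul]
    simpa [hr] using hA

theorem posSemidef_inv_scatter (x : Fin n × Fin p → ℝ) : (scatter x)⁻¹.PosSemidef := by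
  have : (scatter x).PosSemidef := by
    simpa [scatter] using Matrix.posSemidef_self_mul_conjTranspose (unvec x)
  exact this.inv

/-! ### Spherical measures and the constant of the diagonal entries -/

/-- The centered spherical measure with radial profile `h`. -/
noncomputable def spherical (ι : Type*) [Fintype ι] (h : ℝ → ℝ) : Measure (ι → ℝ) :=
  volume.withDensity fun x => ENNReal.ofReal (h (x ⬝ᵥ x))

theorem dotProduct_self_nonneg' {ι : Type*} [Fintype ι] (x : ι → ℝ) : 0 ≤ x ⬝ᵥ x :=
  Finset.sum_nonneg fun i _ => mul_self_nonneg (x i)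

/-- Since `h` is controlled only on `[0, ∞)`, truncation gives a measurable profile on all of `ℝ`
that agrees with it there. -/
theorem measurable_comp_max {h : ℝ → ℝ} (hh : Measurable fun t : Set.Ici (0 : ℝ) => h t) :
    Measurable fun t : ℝ => h (max 0 t) :=
  hh.comp (g := fun t : Set.Ici (0 : ℝ) => h t)
    (f := fun t : ℝ => ⟨max 0 t, Set.mem_Ici.2 (le_max_left _ _)⟩)
    (Measurable.subtype_mk (measurable_const.max measurable_id))

theorem measurable_profile {ι : Type*} [Fintype ι] {h : ℝ → ℝ}
    (hh : Measurable fun t : Set.Ici (0 : ℝ) => h t) :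
    Measurable fun x : ι → ℝ => h (x ⬝ᵥ x) := by
  have h1 : (fun x : ι → ℝ => h (x ⬝ᵥ x)) = fun x => h (max 0 (x ⬝ᵥ x)) := by
    funext x
    rw [max_eq_right (dotProduct_self_nonneg' x)]
  have h2 : Measurable fun x : ι → ℝ => x ⬝ᵥ x := by
    simp only [dotProduct]
    fun_prop
  rw [h1]
  exact (measurable_comp_max hh).comp h2

/-- A linear change of variables that brings an elliptical measure to the spherical one. -/
theorem map_mulVec_withDensity {ι : Type*} [Fintype ι] [DecidableEq ι] {h : ℝ → ℝ}
    (hh : Measurable fun t : Set.Ici (0 : ℝ) => h t) {M : Matrix ι ι ℝ} (hM : M.det ≠ 0) :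
    (volume.withDensity fun x => ENNReal.ofReal (|M.det| * h (M.mulVec x ⬝ᵥ M.mulVec x))).map
      M.mulVec = spherical ι h := by
  have hMm : Measurable M.mulVec :=
    (show Continuous M.mulVec from continuous_const.matrix_mulVec continuous_id).measurable
  have hmap : Measure.map M.mulVec volume = ENNReal.ofReal |M.det⁻¹| • volume :=
    Real.map_matrix_volume_pi_eq_smul_volume_pi hM
  ext s hs
  set φ := s.indicator fun x : ι → ℝ => ENNReal.ofReal (h (x ⬝ᵥ x)) with hφ
  have hf : Measurable φ := (measurable_profile hh).ennreal_ofReal.indicator hs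
  rw [Measure.map_apply hMm hs, withDensity_apply _ (hMm hs), spherical, withDensity_apply _ hs,
    ← lintegral_indicator (hMm hs), ← lintegral_indicator hs]
  have h1 : ∀ x, (M.mulVec ⁻¹' s).indicator
      (fun x => ENNReal.ofReal (|M.det| * h (M.mulVec x ⬝ᵥ M.mulVec x))) x =
      ENNReal.ofReal |M.det| *
        φ (M.mulVec x) := fun x => by
    rw [hφ]
    by_cases hx : M.mulVec x ∈ s
    · rw [Set.indicator_of_mem (by exact hx), Set.indicator_of_mem hx,
        ENNReal.ofReal_mul (abs_nonneg _)]
    · rw [Set.indicator_of_notMem (by exact hx), Set.indicator_of_notMem hx, mul_zero]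
  rw [lintegral_congr h1, lintegral_const_mul' _ _ ENNReal.ofReal_ne_top,
    ← lintegral_map hf hMm, hmap,
    lintegral_smul_measure, smul_eq_mul, ← mul_assoc, ← ENNReal.ofReal_mul (abs_nonneg _),
    ← abs_mul, mul_inv_cancel₀ hM, abs_one, ENNReal.ofReal_one, one_mul]

theorem measurable_inv_scatter (i j : Fin p) :
    Measurable fun x : Fin n × Fin p → ℝ => (scatter x)⁻¹ i j :=
  (measurable_inv_entry i j).comp measurable_scatter

theorem exists_lintegral_inv_scatter (hp : 0 < p) (hn : 0 < n) (i : Fin p) :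
    ∃ C : ENNReal, ∀ g : ℝ → ENNReal, Measurable g →
      ∫⁻ x : Fin n × Fin p → ℝ, ENNReal.ofReal ((scatter x)⁻¹ i i) * g (x ⬝ᵥ x) =
        C * ∫⁻ t in Set.Ioi (0 : ℝ), ENNReal.ofReal (t ^ (((n * p : ℕ) : ℝ) / 2 - 2)) * g t := by
  have hmp := PiLp.volume_preserving_ofLp (Fin n × Fin p)
  have hdim : Module.finrank ℝ (EuclideanSpace ℝ (Fin n × Fin p)) = n * p := by simp
  have : Nontrivial (EuclideanSpace ℝ (Fin n × Fin p)) :=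
    Module.nontrivial_of_finrank_pos (R := ℝ) (by rw [hdim]; positivity)
  obtain ⟨C, hC⟩ := exists_lintegral_homogeneous_mul_radial
    (volume : Measure (EuclideanSpace ℝ (Fin n × Fin p)))
    (F := fun x => ENNReal.ofReal ((scatter (WithLp.ofLp x))⁻¹ i i))
    ((measurable_inv_scatter i i).comp hmp.measurable).ennreal_ofReal (fun r hr x => by
      rw [WithLp.ofLp_smul, scatter_smul, inv_smul_of_ne_zero (by positivity), Matrix.smul_apply,
        smul_eq_mul, ENNReal.ofReal_mul (by positivity), ENNReal.ofReal_inv_of_pos (by positivity)])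
  refine ⟨C, fun g hg => ?_⟩
  rw [← hdim, ← hC g hg]
  have hq : Measurable fun x : Fin n × Fin p → ℝ => x ⬝ᵥ x := by
    simp only [dotProduct]
    fun_prop
  have hmeas : Measurable fun x : Fin n × Fin p → ℝ =>
      ENNReal.ofReal ((scatter x)⁻¹ i i) * g (x ⬝ᵥ x) :=
    (measurable_inv_scatter i i).ennreal_ofReal.mul (hg.comp hq)
  rw [← hmp.lintegral_comp hmeas]
  have hnorm : ∀ x : EuclideanSpace ℝ (Fin n × Fin p),
      ‖x‖ ^ 2 = WithLp.ofLp x ⬝ᵥ WithLp.ofLp x := fun x => by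
    rw [EuclideanSpace.norm_sq_eq]
    simp only [dotProduct, Real.norm_eq_abs, sq, abs_mul_abs_self]
  exact lintegral_congr fun x => by rw [hnorm x]

theorem lintegral_inv_scatter_mul_exp (hn : p + 1 < n) (i : Fin p) :
    ∫⁻ x : Fin n × Fin p → ℝ, ENNReal.ofReal ((scatter x)⁻¹ i i) *
        ENNReal.ofReal (Real.exp (-(x ⬝ᵥ x))) =
      ENNReal.ofReal (2 / ((n : ℝ) - p - 1)) *
        ENNReal.ofReal (Real.pi ^ (((n * p : ℕ) : ℝ) / 2)) := by
  obtain ⟨m, rfl⟩ : ∃ m, p = m + 1 := ⟨p - 1, by have := i.pos; omega⟩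
  have hq : Measurable fun x : Fin n × Fin (m + 1) → ℝ =>
      ENNReal.ofReal (Real.exp (-(x ⬝ᵥ x))) := by
    simp only [dotProduct]
    fun_prop
  have hmeas : Measurable fun x : Fin n × Fin (m + 1) → ℝ =>
      ENNReal.ofReal ((scatter x)⁻¹ i i) * ENNReal.ofReal (Real.exp (-(x ⬝ᵥ x))) :=
    (measurable_inv_scatter i i).ennreal_ofReal.mul hq
  rw [← measurePreserving_vecOfRows.lintegral_comp hmeas]
  simp only [scatter_vecOfRows, vecOfRows_dotProduct_self]
  rw [lintegral_inv_gram_mul_exp (by simpa using hn)]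
  simp only [finrank_euclideanSpace, Fintype.card_fin]
  push_cast
  ring_nf

/-- The diagonal of the inverse scatter matrix integrated against a radial function. -/
theorem lintegral_inv_scatter_mul_radial (hn : p + 1 < n) (i : Fin p)
    {g : ℝ → ENNReal} (hg : Measurable g) :
    ∫⁻ x : Fin n × Fin p → ℝ, ENNReal.ofReal ((scatter x)⁻¹ i i) * g (x ⬝ᵥ x) =
      ENNReal.ofReal (((n : ℝ) * p - 2) / ((n : ℝ) - p - 1) *
        (Real.pi ^ (((n * p : ℕ) : ℝ) / 2) / Real.Gamma (((n * p : ℕ) : ℝ) / 2))) *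
        ∫⁻ t in Set.Ioi (0 : ℝ), ENNReal.ofReal (t ^ (((n * p : ℕ) : ℝ) / 2 - 2)) * g t := by
  have hp := i.pos
  obtain ⟨C, hC⟩ := exists_lintegral_inv_scatter (n := n) hp (by omega) i
  have h1 := hC (fun t => ENNReal.ofReal (Real.exp (-t))) (by fun_prop)
  have hnp : 2 < n * p := lt_of_lt_of_le (by omega : 2 < n) (Nat.le_mul_of_pos_right n hp)
  set d : ℝ := ((n * p : ℕ) : ℝ) with hd
  have hd2 : 2 < d := by
    rw [hd]
    exact_mod_cast hnp
  have hk : 0 < (n : ℝ) - p - 1 := by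
    have : ((p + 1 : ℕ) : ℝ) < n := by exact_mod_cast hn
    push_cast at this
    linarith
  have hGpos : 0 < Real.Gamma (d / 2 - 1) := Real.Gamma_pos_of_pos (by linarith)
  have hG : Real.Gamma (d / 2) = (d / 2 - 1) * Real.Gamma (d / 2 - 1) := by
    have := Real.Gamma_add_one (s := d / 2 - 1) (by linarith)
    rwa [sub_add_cancel] at this
  rw [lintegral_inv_scatter_mul_exp hn i, show d / 2 - 2 = (d / 2 - 1) - 1 by ring,
    lintegral_rpow_mul_exp_neg (by linarith), ← ENNReal.ofReal_mul (by positivity)] at h1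
  have hCval : C = ENNReal.ofReal (((n : ℝ) * p - 2) / ((n : ℝ) - p - 1) *
        (Real.pi ^ (d / 2) / Real.Gamma (d / 2))) := by
    -- Solving the Gaussian identity for `C` is legitimate because `Γ(d/2 - 1)` is positive and
    -- finite.
    have h2 : C = ENNReal.ofReal (2 / ((n : ℝ) - p - 1) * Real.pi ^ (d / 2)) /
        ENNReal.ofReal (Real.Gamma (d / 2 - 1)) := by
      rw [h1, ENNReal.mul_div_cancel_right (by simpa using hGpos) ENNReal.ofReal_ne_top]
    rw [h2, ← ENNReal.ofReal_div_of_pos hGpos, hG,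
      show (n : ℝ) * p = d by rw [hd]; push_cast; ring]
    congr 1
    have : d - 2 ≠ 0 := by linarith
    field_simp
  rw [hC g hg, hCval]

/-! ### Mean of the inverse scatter matrix under a spherical measure -/

section Spherical

variable {h : ℝ → ℝ}

theorem lintegral_spherical {ι : Type*} [Fintype ι]
    (hh : Measurable fun t : Set.Ici (0 : ℝ) => h t) {F : (ι → ℝ) → ENNReal} (hF : Measurable F) :
    ∫⁻ x, F x ∂spherical ι h = ∫⁻ x, F x * ENNReal.ofReal (h (max 0 (x ⬝ᵥ x))) := by
  rw [spherical, lintegral_withDensity_eq_lintegral_mul _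
    (measurable_profile hh).ennreal_ofReal hF]
  refine lintegral_congr fun x => ?_
  rw [Pi.mul_apply, mul_comm, max_eq_right (dotProduct_self_nonneg' x)]

theorem lintegral_inv_scatter_spherical (hn : p + 1 < n)
    (hh : Measurable fun t : Set.Ici (0 : ℝ) => h t) (h0 : ∀ t, 0 ≤ t → 0 ≤ h t)
    (hm : FiniteModularMoment (n * p) h (-1)) (i : Fin p) :
    ∫⁻ x : Fin n × Fin p → ℝ, ENNReal.ofReal ((scatter x)⁻¹ i i) ∂spherical _ h =
      ENNReal.ofReal (((n : ℝ) * p - 2) / ((n : ℝ) - p - 1) *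
        modularMoment (n * p) h (-1)) := by
  have hp := i.pos
  have hnp : 2 < n * p := lt_of_lt_of_le (by omega : 2 < n) (Nat.le_mul_of_pos_right n hp)
  have hnp' : 2 < (n : ℝ) * p := by exact_mod_cast hnp
  have hk : 0 < (n : ℝ) - p - 1 := by
    have : ((p + 1 : ℕ) : ℝ) < n := by exact_mod_cast hn
    push_cast at this
    linarith
  have hexp : ((n * p : ℕ) : ℝ) / 2 + ((-1 : ℤ) : ℝ) - 1 = ((n * p : ℕ) : ℝ) / 2 - 2 := by
    push_cast
    ring
  rw [lintegral_spherical hh (measurable_inv_scatter i i).ennreal_ofReal,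
    lintegral_inv_scatter_mul_radial hn i
      (g := fun t => ENNReal.ofReal (h (max 0 t))) (measurable_comp_max hh).ennreal_ofReal]
  rw [FiniteModularMoment, hexp] at hm
  have h1 : ∫⁻ t in Set.Ioi (0 : ℝ), ENNReal.ofReal (t ^ (((n * p : ℕ) : ℝ) / 2 - 2)) *
      ENNReal.ofReal (h (max 0 t)) =
      ENNReal.ofReal (∫ t in Set.Ioi (0 : ℝ), h t * t ^ (((n * p : ℕ) : ℝ) / 2 - 2)) := by
    rw [ofReal_integral_eq_lintegral_ofReal hm]
    · refine setLIntegral_congr_fun measurableSet_Ioi fun t ht => ?_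
      have ht : 0 < t := ht
      rw [max_eq_right ht.le, mul_comm, ENNReal.ofReal_mul (h0 t ht.le)]
    · filter_upwards [ae_restrict_mem measurableSet_Ioi] with t ht
      have ht : 0 < t := ht
      exact mul_nonneg (h0 t ht.le) (by positivity)
  have hGam : 0 < Real.Gamma (((n * p : ℕ) : ℝ) / 2) := Real.Gamma_pos_of_pos (by
    push_cast
    linarith)
  have hnn : 0 ≤ ((n : ℝ) * p - 2) / ((n : ℝ) - p - 1) := div_nonneg (by linarith) hk.le
  rw [h1, ← ENNReal.ofReal_mul (by positivity), modularMoment, hexp, mul_assoc]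

theorem integrable_inv_scatter_apply_self (hn : p + 1 < n)
    (hh : Measurable fun t : Set.Ici (0 : ℝ) => h t) (h0 : ∀ t, 0 ≤ t → 0 ≤ h t)
    (hm : FiniteModularMoment (n * p) h (-1)) (i : Fin p) :
    Integrable (fun x : Fin n × Fin p → ℝ => (scatter x)⁻¹ i i) (spherical _ h) := by
  refine ⟨(measurable_inv_scatter i i).aestronglyMeasurable, ?_⟩
  rw [hasFiniteIntegral_iff_ofReal
    (Filter.Eventually.of_forall fun x => (posSemidef_inv_scatter x).diag_nonneg),
    lintegral_inv_scatter_spherical hn hh h0 hm i]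
  exact ENNReal.ofReal_lt_top

/-- Evaluate the quadratic form at `e_i + e_j` and `e_i - e_j`. This dominates off-diagonal entries
by integrable diagonal ones. -/
theorem _root_.Matrix.PosSemidef.two_mul_abs_apply_le {ι : Type*} [Fintype ι] [DecidableEq ι]
    {A : Matrix ι ι ℝ} (hA : A.PosSemidef) (i j : ι) : 2 * |A i j| ≤ A i i + A j j := by
  have hsymm : A j i = A i j := by simpa using hA.isHermitian.apply i j
  have key : ∀ c : ℝ, 0 ≤ A i i + c * A i j + c * A j i + c * c * A j j := fun c => by
    have h := hA.dotProduct_mulVec_nonneg (Pi.single i 1 + c • Pi.single j 1)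
    simp [Matrix.mulVec_add, Matrix.mulVec_smul, add_dotProduct] at h
    linarith
  have h1 := key 1
  have h2 := key (-1)
  rcases abs_cases (A i j) with ⟨h, _⟩ | ⟨h, _⟩ <;> rw [h] <;> linarith

theorem integrable_inv_scatter (hn : p + 1 < n)
    (hh : Measurable fun t : Set.Ici (0 : ℝ) => h t) (h0 : ∀ t, 0 ≤ t → 0 ≤ h t)
    (hm : FiniteModularMoment (n * p) h (-1)) (i j : Fin p) :
    Integrable (fun x : Fin n × Fin p → ℝ => (scatter x)⁻¹ i j) (spherical _ h) := by
  refine Integrable.mono' ((integrable_inv_scatter_apply_self hn hh h0 hm i).add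
    (integrable_inv_scatter_apply_self hn hh h0 hm j))
    (measurable_inv_scatter i j).aestronglyMeasurable (Filter.Eventually.of_forall fun x => ?_)
  have := (posSemidef_inv_scatter x).two_mul_abs_apply_le i j
  have h2 := abs_nonneg ((scatter x)⁻¹ i j)
  rw [Real.norm_eq_abs, Pi.add_apply]
  linarith

theorem kronecker_mulVec_eq (B : Matrix (Fin p) (Fin p) ℝ) (x : Fin n × Fin p → ℝ) :
    ((1 : Matrix (Fin n) (Fin n) ℝ) ⊗ₖ B).mulVec x = (B * unvec x).vec := by
  rw [Matrix.vec_mul_eq_mulVec, vec_unvec]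

theorem scatter_kronecker_mulVec (B : Matrix (Fin p) (Fin p) ℝ) (x : Fin n × Fin p → ℝ) :
    scatter (((1 : Matrix (Fin n) (Fin n) ℝ) ⊗ₖ B).mulVec x) = B * scatter x * B.transpose := by
  rw [kronecker_mulVec_eq, scatter, unvec_vec, Matrix.transpose_mul, scatter]
  simp only [Matrix.mul_assoc]

theorem integral_inv_scatter_of_ne (hh : Measurable fun t : Set.Ici (0 : ℝ) => h t) {i j : Fin p}
    (hij : i ≠ j) : ∫ x : Fin n × Fin p → ℝ, (scatter x)⁻¹ i j ∂spherical _ h = 0 := by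
  -- The reflection that flips row `i` of `X`; conjugating by it negates the `(i, j)` entry. The
  -- resulting identity `I = -I` requires no integrability.
  set e : Fin p → ℝ := fun k => if k = i then -1 else 1 with he
  have hee : ∀ k, e k * e k = 1 := fun k => by
    rw [he]
    dsimp only
    split_ifs <;> norm_num
  set D : Matrix (Fin p) (Fin p) ℝ := Matrix.diagonal e with hD
  have hDD : D * D = 1 := by
    rw [hD, Matrix.diagonal_mul_diagonal]
    simp [hee]
  have hDi : D⁻¹ = D := Matrix.inv_eq_right_inv hDD
  set M := (1 : Matrix (Fin n) (Fin n) ℝ) ⊗ₖ D with hM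
  have hMM : M * M = 1 := by
    rw [hM, ← Matrix.mul_kronecker_mul, hDD, one_mul, Matrix.one_kronecker_one]
  have hMT : M.transpose = M := by
    rw [hM, ← Matrix.kroneckerMap_transpose, hD]
    simp
  have hdet : M.det * M.det = 1 := by rw [← Matrix.det_mul, hMM, Matrix.det_one]
  have hdet0 : M.det ≠ 0 := left_ne_zero_of_mul_eq_one hdet
  have habs : |M.det| = 1 := by
    have := abs_mul_abs_self M.det
    rw [hdet] at this
    nlinarith [abs_nonneg M.det]
  have hmap := map_mulVec_withDensity hh hdet0
  have hnorm : ∀ x, M.mulVec x ⬝ᵥ M.mulVec x = x ⬝ᵥ x := fun x => by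
    rw [Matrix.dotProduct_mulVec, Matrix.vecMul_mulVec, hMT, hMM, Matrix.vecMul_one]
  simp only [habs, one_mul, hnorm] at hmap
  have hMm : Measurable M.mulVec :=
    (show Continuous M.mulVec from continuous_const.matrix_mulVec continuous_id).measurable
  have h1 : ∫ x : Fin n × Fin p → ℝ, (scatter x)⁻¹ i j ∂spherical _ h =
      ∫ x : Fin n × Fin p → ℝ, (scatter (M.mulVec x))⁻¹ i j ∂spherical _ h := by
    conv_lhs => rw [← hmap]
    rw [integral_map hMm.aemeasurable (measurable_inv_scatter i j).aestronglyMeasurable]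
    rfl
  have h2 : ∀ x : Fin n × Fin p → ℝ,
      (scatter (M.mulVec x))⁻¹ i j = -(scatter x)⁻¹ i j := fun x => by
    rw [hM, scatter_kronecker_mulVec, Matrix.mul_inv_rev, Matrix.mul_inv_rev, hD,
      Matrix.diagonal_transpose, ← hD, hDi, hD, Matrix.diagonal_mul, Matrix.mul_diagonal]
    simp [he, hij.symm]
  rw [integral_congr_ae (Filter.Eventually.of_forall h2), integral_neg] at h1
  linarith

theorem integral_inv_scatter (hn : p + 1 < n)
    (hh : Measurable fun t : Set.Ici (0 : ℝ) => h t) (h0 : ∀ t, 0 ≤ t → 0 ≤ h t)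
    (hm : FiniteModularMoment (n * p) h (-1)) (i j : Fin p) :
    ∫ x : Fin n × Fin p → ℝ, (scatter x)⁻¹ i j ∂spherical _ h =
      ((n : ℝ) * p - 2) / ((n : ℝ) - p - 1) * modularMoment (n * p) h (-1) *
        (1 : Matrix (Fin p) (Fin p) ℝ) i j := by
  by_cases hij : i = j
  · subst hij
    have hp := i.pos
    have hnp : 2 < n * p := lt_of_lt_of_le (by omega : 2 < n) (Nat.le_mul_of_pos_right n hp)
    have hnp' : 2 < (n : ℝ) * p := by exact_mod_cast hnp
    have hk : 0 < (n : ℝ) - p - 1 := by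
      have : ((p + 1 : ℕ) : ℝ) < n := by exact_mod_cast hn
      push_cast at this
      linarith
    have hGam : 0 < Real.Gamma (((n * p : ℕ) : ℝ) / 2) := Real.Gamma_pos_of_pos (by
      push_cast
      linarith)
    have hmom : 0 ≤ modularMoment (n * p) h (-1) :=
      mul_nonneg (by positivity) (setIntegral_nonneg measurableSet_Ioi fun t ht =>
        mul_nonneg (h0 t (le_of_lt ht)) (Real.rpow_nonneg (le_of_lt ht) _))
    rw [integral_eq_lintegral_of_nonneg_ae
      (Filter.Eventually.of_forall fun x => (posSemidef_inv_scatter x).diag_nonneg)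
      (measurable_inv_scatter i i).aestronglyMeasurable,
      lintegral_inv_scatter_spherical hn hh h0 hm i, ENNReal.toReal_ofReal
      (mul_nonneg (div_nonneg (by linarith) hk.le) hmom), Matrix.one_apply_eq, mul_one]
  · rw [integral_inv_scatter_of_ne hh hij, Matrix.one_apply_ne hij, mul_zero]

end Spherical

/-! ### Transport to a general center matrix -/

theorem exists_transpose_mul_self {Sig : Matrix (Fin p) (Fin p) ℝ} (hSig : Sig.PosDef) :
    ∃ B : Matrix (Fin p) (Fin p) ℝ, B.det ≠ 0 ∧ Sig = B.transpose * B := by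
  obtain ⟨B, hB⟩ : ∃ B : Matrix (Fin p) (Fin p) ℝ, Sig = B.transpose * B := by
    open scoped MatrixOrder in
    obtain ⟨B, hB⟩ := CStarAlgebra.nonneg_iff_eq_star_mul_self.1 hSig.posSemidef.nonneg
    exact ⟨B, by simpa [Matrix.star_eq_conjTranspose] using hB⟩
  refine ⟨B, fun h => ?_, hB⟩
  have := hSig.det_pos
  rw [hB, Matrix.det_mul, h, mul_zero] at this
  exact this.false

/-- The elliptical Wishart distribution is an image of the spherical measure. -/
theorem ellipticalWishart_inv_eq_map {h : ℝ → ℝ}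
    (hh : Measurable fun t : Set.Ici (0 : ℝ) => h t) {B : Matrix (Fin p) (Fin p) ℝ}
    (hB : B.det ≠ 0) :
    ellipticalWishart n (B.transpose * B)⁻¹ h =
      (spherical (Fin n × Fin p) h).map fun x => B⁻¹ * scatter x * B⁻¹.transpose := by
  set M := (1 : Matrix (Fin n) (Fin n) ℝ) ⊗ₖ B with hM
  have hdetM : M.det = B.det ^ n := by
    rw [hM, Matrix.det_kronecker]
    simp
  have hM0 : M.det ≠ 0 := by
    rw [hdetM]
    exact pow_ne_zero _ hB
  have hBT : (B.transpose * B).det = B.det ^ 2 := by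
    rw [Matrix.det_mul, Matrix.det_transpose, sq]
  have hell : ellipticalVector ((1 : Matrix (Fin n) (Fin n) ℝ) ⊗ₖ (B.transpose * B)⁻¹) h =
      volume.withDensity fun x =>
        ENNReal.ofReal (|M.det| * h (M.mulVec x ⬝ᵥ M.mulVec x)) := by
    rw [ellipticalVector]
    congr 1
    funext x
    congr 2
    -- The center is `(Bᵀ B)⁻¹`, so its Kronecker product with `1` has determinant `(det M ^ 2)⁻¹`,
    -- whose power `-1/2` is `|det M|`.
    · rw [Matrix.det_kronecker, Matrix.det_one, one_pow, one_mul, Fintype.card_fin,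
        Matrix.det_nonsing_inv, Ring.inverse_eq_inv', hBT, inv_pow, ← pow_mul, mul_comm 2 n,
        pow_mul, ← hdetM, Real.rpow_neg (by positivity), Real.inv_rpow (by positivity), inv_inv,
        ← Real.sqrt_eq_rpow, Real.sqrt_sq_eq_abs]
    · rw [Matrix.inv_kronecker, inv_one, Matrix.nonsing_inv_nonsing_inv _
        (by rw [hBT]; exact isUnit_iff_ne_zero.2 (pow_ne_zero 2 hB)),
        Matrix.dotProduct_mulVec (M.mulVec x), Matrix.vecMul_mulVec,
        ← Matrix.dotProduct_mulVec x, dotProduct_comm x, hM, ← Matrix.kroneckerMap_transpose,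
        ← Matrix.mul_kronecker_mul, Matrix.transpose_one, one_mul]
      rw [dotProduct_comm]
  have hMm : Measurable M.mulVec :=
    (show Continuous M.mulVec from continuous_const.matrix_mulVec continuous_id).measurable
  have hg : Measurable fun x : Fin n × Fin p → ℝ => B⁻¹ * scatter x * B⁻¹.transpose := by
    refine measurable_pi_lambda _ fun i => measurable_pi_lambda _ fun j => ?_
    exact (Continuous.matrix_elem ((continuous_const.matrix_mul continuous_scatter).matrix_mul
      continuous_const) i j).measurable
  rw [ellipticalWishart, ellipticalMatrix, hell, Measure.map_map measurable_mul_transpose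
    measurable_unvec, ← map_mulVec_withDensity hh hM0, Measure.map_map hg hMm]
  congr 1
  funext x
  simp only [Function.comp_apply, hM, scatter_kronecker_mulVec]
  have h1 : B⁻¹ * B = 1 := Matrix.nonsing_inv_mul B (isUnit_iff_ne_zero.2 hB)
  have h2 : B.transpose * B⁻¹.transpose = 1 := by
    rw [← Matrix.transpose_mul, h1, Matrix.transpose_one]
  rw [show B⁻¹ * (B * scatter x * B.transpose) * B⁻¹.transpose =
    (B⁻¹ * B) * scatter x * (B.transpose * B⁻¹.transpose) by simp only [Matrix.mul_assoc], h1, h2,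
    one_mul, mul_one, scatter]

/-- The expectation of an inverse elliptical Wishart matrix. -/
theorem integrable_and_matrixExpectation_of_isInverseEllipticalWishart {Ω : Type*}
    [MeasurableSpace Ω] (P : Measure Ω) [IsProbabilityMeasure P]
    (p n : ℕ) (hp : 1 ≤ p) (hn : p + 1 < n)
    (Sig : Matrix (Fin p) (Fin p) ℝ) (hSig : Sig.PosDef)
    (h : ℝ → ℝ) (hh : IsDensityGenerator (n * p) h)
    (hm : FiniteModularMoment (n * p) h (-1))
    (S : Ω → Matrix (Fin p) (Fin p) ℝ)
    (hS : IsInverseEllipticalWishart n Sig h S P) :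
    (∀ i j, Integrable (fun ω => S ω i j) P) ∧
      matrixExpectation S P =
        (((n : ℝ) * (p : ℝ) - 2) / ((n : ℝ) - (p : ℝ) - 1) *
          modularMoment (n * p) h (-1)) • Sig := by
  obtain ⟨B, hB, rfl⟩ := exists_transpose_mul_self hSig
  have hlaw := hS.2
  rw [ellipticalWishart_inv_eq_map hh.measurable hB] at hlaw
  set c := ((n : ℝ) * (p : ℝ) - 2) / ((n : ℝ) - (p : ℝ) - 1) * modularMoment (n * p) h (-1) with hc
  set μ := spherical (Fin n × Fin p) h with hμ
  set g := fun x : Fin n × Fin p → ℝ => B⁻¹ * scatter x * B⁻¹.transpose with hgdef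
  have hg : Measurable g := by
    refine measurable_pi_lambda _ fun i => measurable_pi_lambda _ fun j => ?_
    exact (Continuous.matrix_elem ((continuous_const.matrix_mul continuous_scatter).matrix_mul
      continuous_const) i j).measurable
  have hBi : B⁻¹.det ≠ 0 := by
    rw [Matrix.det_nonsing_inv, Ring.inverse_eq_inv']
    exact inv_ne_zero hB
  have hset : MeasurableSet {A : Matrix (Fin p) (Fin p) ℝ | A.det ≠ 0} :=
    measurable_det (measurableSet_singleton 0).compl
  have hdet : ∀ᵐ ω ∂P, (S ω)⁻¹.det ≠ 0 := by
    refine ae_of_ae_map (p := fun A : Matrix (Fin p) (Fin p) ℝ => A.det ≠ 0)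
      hlaw.aemeasurable ?_
    rw [hlaw.map_eq, ae_map_iff hg.aemeasurable hset]
    filter_upwards [(withDensity_absolutelyContinuous volume _).ae_le
      (ae_det_scatter_ne_zero (show p ≤ n by omega))] with x hx
    rw [hgdef]
    simp only [Matrix.det_mul, Matrix.det_transpose]
    exact mul_ne_zero (mul_ne_zero hBi hx) hBi
  -- The law is prescribed for `S⁻¹` only. A singular `S ω` would have inverse `0`, of determinant
  -- `0` because `p ≥ 1`, which almost surely does not occur.
  have hinv : ∀ᵐ ω ∂P, S ω = (S ω)⁻¹⁻¹ := by
    filter_upwards [hdet] with ω hω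
    by_cases hu : IsUnit (S ω).det
    · exact (Matrix.nonsing_inv_nonsing_inv _ hu).symm
    · have : Nonempty (Fin p) := ⟨⟨0, hp⟩⟩
      rw [Matrix.nonsing_inv_apply_not_isUnit _ hu, Matrix.det_zero] at hω
      exact absurd rfl hω
  have hginv : ∀ x i j, (g x)⁻¹ i j =
      ∑ l, (∑ k, B k i * (scatter x)⁻¹ k l) * B l j := fun x i j => by
    rw [hgdef]
    simp only
    rw [Matrix.mul_inv_rev, Matrix.mul_inv_rev, ← Matrix.transpose_nonsing_inv,
      Matrix.nonsing_inv_nonsing_inv _ (isUnit_iff_ne_zero.2 hB), ← Matrix.mul_assoc]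
    simp only [Matrix.mul_apply, Matrix.transpose_apply]
  have hint : ∀ k l, Integrable (fun x => (scatter x)⁻¹ k l) μ :=
    integrable_inv_scatter hn hh.measurable hh.nonneg hm
  have hgint : ∀ i j, Integrable (fun x => (g x)⁻¹ i j) μ := fun i j => by
    simp only [hginv]
    exact integrable_finsetSum _ fun l _ =>
      (integrable_finsetSum _ fun k _ => (hint k l).const_mul _).mul_const _
  have hmeas : ∀ i j, AEStronglyMeasurable (fun A : Matrix (Fin p) (Fin p) ℝ => A⁻¹ i j)
      (μ.map g) := fun i j => (measurable_inv_entry i j).aestronglyMeasurable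
  refine ⟨fun i j => ?_, ?_⟩
  · have h1 : Integrable (fun A : Matrix (Fin p) (Fin p) ℝ => A⁻¹ i j) (μ.map g) :=
      (integrable_map_measure (hmeas i j) hg.aemeasurable).2 (hgint i j)
    rw [← hlaw.map_eq] at h1
    refine (h1.comp_aemeasurable hlaw.aemeasurable).congr ?_
    filter_upwards [hinv] with ω hω
    rw [Function.comp_apply, ← hω]
  · ext i j
    have h1 : ∫ ω, S ω i j ∂P = ∫ ω, (S ω)⁻¹⁻¹ i j ∂P := by
      refine integral_congr_ae ?_
      filter_upwards [hinv] with ω hω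
      rw [← hω]
    have h2 : ∫ ω, (S ω)⁻¹⁻¹ i j ∂P = ∫ x, (g x)⁻¹ i j ∂μ :=
      (hlaw.integral_comp (hmeas i j)).trans (integral_map hg.aemeasurable (hmeas i j))
    rw [matrixExpectation, Matrix.of_apply, h1, h2]
    simp only [hginv]
    rw [integral_finsetSum _ fun l _ =>
      (integrable_finsetSum _ fun k _ => (hint k l).const_mul _).mul_const _]
    simp_rw [integral_mul_const]
    have h3 : ∀ l, ∫ x, ∑ k, B k i * (scatter x)⁻¹ k l ∂μ = c * B l i := fun l => by
      rw [integral_finsetSum _ fun k _ => (hint k l).const_mul _]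
      simp_rw [integral_const_mul, hμ,
        integral_inv_scatter hn hh.measurable hh.nonneg hm, ← hc]
      simp [Matrix.one_apply, mul_comm]
    simp only [h3, Matrix.smul_apply, Matrix.mul_apply, Matrix.transpose_apply, smul_eq_mul,
      Finset.mul_sum]
    exact Finset.sum_congr rfl fun l _ => by ring

end EllipticalWishart

theorem mainTheorem7 {Ω : Type*} [MeasurableSpace Ω] (P : Measure Ω) [IsProbabilityMeasure P]
    (p n : ℕ) (hp : 1 ≤ p) (hn : p + 1 < n)
    (Sig : Matrix (Fin p) (Fin p) ℝ) (hSig : Sig.PosDef)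
    (h : ℝ → ℝ) (hh : EllipticalWishart.IsDensityGenerator (n * p) h)
    (hm : EllipticalWishart.FiniteModularMoment (n * p) h (-1))
    (S : Ω → Matrix (Fin p) (Fin p) ℝ)
    (hS : EllipticalWishart.IsInverseEllipticalWishart n Sig h S P) :
    (∀ i j, Integrable (fun ω => S ω i j) P) ∧
      EllipticalWishart.matrixExpectation S P =
        (((n : ℝ) * (p : ℝ) - 2) / ((n : ℝ) - (p : ℝ) - 1) *
          EllipticalWishart.modularMoment (n * p) h (-1)) • Sig :=
  EllipticalWishart.integrable_and_matrixExpectation_of_isInverseEllipticalWishart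
    P p n hp hn Sig hSig h hh hm S hS
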